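/- **Theorem 1 (sensitivity).** Let $f_0:\mathbb{R}^n\to\mathbb{R}$ be locally Lipschitz continuous, let $X\subset\mathbb{R}^n$ be nonempty and compact, let $f_{ik}:\mathbb{R}^{m_k}\times\mathbb{R}^n\to\mathbb{R}$ be continuously differentiable for $k=1,\dots,s$ and $i=1,\dots,r_k$ (with $r_k\ge 1$), let $\|\cdot\|_{(k)}$ be any norm on $\mathbb{R}^{m_k}$, and let $\bar u=(\bar u^1,\dots,\bar u^s)\in\mathbb{R}^m$ with $\bar u^k\in\mathbb{R}^{m_k}$, $m=\sum_{k=1}^s m_k$. For $u\in\mathbb{R}^m$ and $\delta\in\mathbb{R}$ let $$U(u,\delta)=\big\{(v^1,\dots,v^s)\in\mathbb{R}^m \;\big|\; \|v^k-u^k\|_{(k)}\le|\delta|,\ k=1,\dots,s\big\}$$ and define the min-value function $p:\mathbb{R}^{m+1}\to[-\infty,\infty]$ of the robust problem by $$p(u,\delta)=\inf_{x\in X}\ \sup_{v\in U(u,\delta)}\Big( f_0(x)+\sum_{k=1}^s\max_{i=1,\dots,r_k}f_{ik}(v^k,x)\Big).$$ Let $M$ be the set of minimizers over $X$ of the nominal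 objective $x\mapsto f_0(x)+\sum_{k=1}^s\max_{i}f_{ik}(\bar u^k,x)$, let $I_k(x)=\{i \mid f_{ik}(\bar u^k,x)=\max_j f_{jk}(\bar u^k,x)\}$, and let $\nabla_1 f_{ik}(\bar u^k,x)$ be the gradient of $f_{ik}(\cdot,x)$ at $\bar u^k$. Then $p$ is locally Lipschitz continuous at $(\bar u,0)$ (real-valued in a neighborhood and Lipschitz near the point), and its local Lipschitz modulus $\operatorname{lip}p(\bar u,0)=\limsup_{z,z'\to(\bar u,0),\,z\ne z'}|p(z)-p(z')|/\|z-z'\|_2$ satisfies $$\operatorname{lip}p(\bar u,0)\le\max_{\bar x\in M}\sum_{k=1}^s\sum_{i\in I_k(\bar x)}\max_{\|w\|_{(k)}\le1}\sqrt{\|\nabla_1 f_{ik}(\bar u^k,\bar x)\|_2^2+\langle\nabla_1 f_{ik}(\bar u^k,\bar x),w\rangle^2},$$ where all the maxima are attained. When $\|\cdot\|_{(k)}=\|\cdot\|_2$ for all $k$, the right-hand side equals $\sqrt2\,\max_{\bar x\in M}\sum_{k=1}^s\sum_{i\in I_k(\bar x)}\|\nabla_1 f_{ik}(\bar u^k,\bar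 x)\|_2$. Moreover, for each limiting (Mordukhovich) subgradient $(g,\gamma)\in\partial p(\bar u,0)$, $g=(g^1,\dots,g^s)$, there exist $\bar x\in M$, vectors $w_i^k\in\mathbb{R}^{m_k}$ with $\|w_i^k\|_{(k)}\le1$, and numbers $y_i^k\ge0$ ($k=1,\dots,s$, $i\in I_k(\bar x)$) with $\sum_{i\in I_k(\bar x)}y_i^k=1$ for every $k$, such that $$g^k=\sum_{i\in I_k(\bar x)}y_i^k\,\nabla_1 f_{ik}(\bar u^k,\bar x)\quad(k=1,\dots,s),\qquad \gamma=\sum_{k=1}^s\sum_{i\in I_k(\bar x)}y_i^k\,\langle\nabla_1 f_{ik}(\bar u^k,\bar x),w_i^k\rangle.$$ -/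

import Mathlib

noncomputable section

open Filter Topology
open scoped ENNReal

/-! ### Variational analysis of extended real-valued functions -/

section Variational

variable {E : Type*} [NormedAddCommGroup E]

/-- `f` is locally Lipschitz continuous at `xbar`: it is real-valued near `xbar` and Lipschitz
on some closed ball around `xbar`. -/
def LocLipschitzAt (f : E → EReal) (xbar : E) : Prop :=
  ∃ κ ε : ℝ, 0 ≤ κ ∧ 0 < ε ∧
    (∀ x, ‖x - xbar‖ ≤ ε → f x ≠ ⊤ ∧ f x ≠ ⊥) ∧
    ∀ x x', ‖x - xbar‖ ≤ ε → ‖x' - xbar‖ ≤ ε →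
      |(f x).toReal - (f x').toReal| ≤ κ * ‖x - x'‖

/-- The local Lipschitz modulus of `f` at `xbar`: the upper limit of
`|f x - f x'| / ‖x - x'‖` as `x, x' → xbar` with `x ≠ x'`, with values in `[0, ∞]`. -/
def lipModulus (f : E → EReal) (xbar : E) : ℝ≥0∞ :=
  limsup (fun q : E × E => (f q.1 - f q.2).abs / ‖q.1 - q.2‖ₑ)
    (𝓝[{q : E × E | q.1 ≠ q.2}] (xbar, xbar))

variable [InnerProductSpace ℝ E]

/-- `v` is a regular (Fréchet) subgradient of `f` at `x`: `f` is finite at `x` and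
`f z ≥ f x + ⟪v, z - x⟫ + o(‖z - x‖)`. -/
def IsRegularSubgradient (f : E → EReal) (x v : E) : Prop :=
  f x ≠ ⊤ ∧ f x ≠ ⊥ ∧
    ∀ ε : ℝ, 0 < ε → ∀ᶠ z in 𝓝 x,
      f x + ((inner ℝ v (z - x) - ε * ‖z - x‖ : ℝ) : EReal) ≤ f z

/-- `v` is a (limiting, Mordukhovich) subgradient of `f` at `x`: `f` is finite at `x` and `v` is
a limit of regular subgradients of `f` at points `xs j → x` with `f (xs j) → f x`. -/
def IsLimitingSubgradient (f : E → EReal) (x v : E) : Prop :=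
  f x ≠ ⊤ ∧ f x ≠ ⊥ ∧
    ∃ xs vs : ℕ → E, Tendsto xs atTop (𝓝 x) ∧
      Tendsto (fun j => f (xs j)) atTop (𝓝 (f x)) ∧
      (∀ j, IsRegularSubgradient f (xs j) (vs j)) ∧
      Tendsto vs atTop (𝓝 v)

end Variational

/-! ### The nominal and the robust problem -/

/-- The parameter space `ℝ^m = ℝ^{m_1} × ⋯ × ℝ^{m_s}` with its Euclidean norm. -/
abbrev ParamSpace {s : ℕ} (m : Fin s → ℕ) : Type :=
  PiLp 2 (fun k => EuclideanSpace ℝ (Fin (m k)))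

/-- The space `ℝ^{m+1}` of pairs `(u, δ)` with its Euclidean norm. -/
abbrev PerturbSpace {s : ℕ} (m : Fin s → ℕ) : Type :=
  WithLp 2 (ParamSpace m × ℝ)

section Problem

variable {s n : ℕ} {m r : Fin s → ℕ}

/-- `f₀(x) + ∑ₖ maxᵢ f_{ik}(u^k, x)`. -/
def objective (f₀ : EuclideanSpace ℝ (Fin n) → ℝ)
    (f : ∀ k : Fin s, Fin (r k) → EuclideanSpace ℝ (Fin (m k)) → EuclideanSpace ℝ (Fin n) → ℝ)
    (u : ParamSpace m) (x : EuclideanSpace ℝ (Fin n)) : ℝ :=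
  f₀ x + ∑ k, ⨆ i, f k i (u k) x

/-- The uncertainty set `U(u, δ)`, for norms `N k` on the blocks. -/
def uncertaintySet (N : ∀ k, Seminorm ℝ (EuclideanSpace ℝ (Fin (m k))))
    (u : ParamSpace m) (δ : ℝ) : Set (ParamSpace m) :=
  {v | ∀ k, N k (v k - u k) ≤ |δ|}

/-- The min-value function `p` of the robust problem. -/
def minValue (X : Set (EuclideanSpace ℝ (Fin n))) (f₀ : EuclideanSpace ℝ (Fin n) → ℝ)
    (f : ∀ k : Fin s, Fin (r k) → EuclideanSpace ℝ (Fin (m k)) → EuclideanSpace ℝ (Fin n) → ℝ)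
    (N : ∀ k, Seminorm ℝ (EuclideanSpace ℝ (Fin (m k))))
    (z : PerturbSpace m) : EReal :=
  ⨅ x ∈ X, ⨆ v ∈ uncertaintySet N z.fst z.snd, ((objective f₀ f v x : ℝ) : EReal)

/-- The set `M` of minimizers of the nominal problem. -/
def nominalMinimizers (X : Set (EuclideanSpace ℝ (Fin n))) (f₀ : EuclideanSpace ℝ (Fin n) → ℝ)
    (f : ∀ k : Fin s, Fin (r k) → EuclideanSpace ℝ (Fin (m k)) → EuclideanSpace ℝ (Fin n) → ℝ)
    (ubar : ParamSpace m) : Set (EuclideanSpace ℝ (Fin n)) :=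
  {x | x ∈ X ∧ IsMinOn (objective f₀ f ubar) X x}

open Classical in
/-- The active indices `I_k(x)`. -/
def activeIndices
    (f : ∀ k : Fin s, Fin (r k) → EuclideanSpace ℝ (Fin (m k)) → EuclideanSpace ℝ (Fin n) → ℝ)
    (ubar : ParamSpace m) (k : Fin s) (x : EuclideanSpace ℝ (Fin n)) : Finset (Fin (r k)) :=
  Finset.univ.filter fun i => f k i (ubar k) x = ⨆ j, f k j (ubar k) x

/-- The gradient `∇₁ f_{ik}(ubar^k, x)` with respect to the first argument. -/
def grad₁
    (f : ∀ k : Fin s, Fin (r k) → EuclideanSpace ℝ (Fin (m k)) → EuclideanSpace ℝ (Fin n) → ℝ)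
    (ubar : ParamSpace m) (k : Fin s) (i : Fin (r k)) (x : EuclideanSpace ℝ (Fin n)) :
    EuclideanSpace ℝ (Fin (m k)) :=
  gradient (fun v => f k i v x) (ubar k)

/-- The values `√(‖∇₁ f_{ik}(ubar^k, x)‖² + ⟪∇₁ f_{ik}(ubar^k, x), w⟫²)` over `‖w‖_(k) ≤ 1`. -/
def termValues
    (f : ∀ k : Fin s, Fin (r k) → EuclideanSpace ℝ (Fin (m k)) → EuclideanSpace ℝ (Fin n) → ℝ)
    (N : ∀ k, Seminorm ℝ (EuclideanSpace ℝ (Fin (m k))))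
    (ubar : ParamSpace m) (k : Fin s) (i : Fin (r k)) (x : EuclideanSpace ℝ (Fin n)) : Set ℝ :=
  (fun w => √(‖grad₁ f ubar k i x‖ ^ 2 + (inner ℝ (grad₁ f ubar k i x) w) ^ 2)) ''
    {w | N k w ≤ 1}

end Problem

end

open Filter Topology
open scoped ENNReal

/-! ### Seminorms on finite-dimensional spaces -/

/-! Substituting `v = u + δ • w` replaces the moving set `U(u, δ)` by the fixed compact product of
unit balls. Together with a choice of one index per block, this makes the worst case at `x` a
maximum, over a fixed compact set of selections `c = (i, w)`, of functions that are jointly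
continuous and, up to the term `f₀ x`, C¹. Hence `p` is a min-max of continuous functions over
compact sets, so it is finite and all extrema are attained.

Only one-sided estimates are needed. If `x` is optimal at `z'` and `c` is worst for `(x, z)`, then
`p z - p z'` is at most the increment from `z'` to `z` of the single function selected by `c` at the
fixed point `x`; there `f₀` cancels. As `z, z' → (ubar, 0)`, compactness makes optimal points
cluster in `M` and worst indices become active, and strict differentiability gives the limit of the
quotients (`exists_le_sum_inner_of_quotient`): `∑ₖ ⟪∇₁f, d.fst k + d.snd • w k⟫` in the limiting
direction `d`.

This is used twice. For unit `d`, Cauchy–Schwarz bounds the limit by the claimed modulus, and a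
contradiction argument yields the Lipschitz estimate. For a limiting subgradient, with `x` fixed and
`d` arbitrary, it bounds `⟪d, v⟫` by the support function of a compact convex set of multiplier
combinations, and Hahn–Banach separation puts `v` in that set. -/

theorem Seminorm.continuous_finiteDimensional {F : Type*} [NormedAddCommGroup F]
    [NormedSpace ℝ F] [FiniteDimensional ℝ F] (q : Seminorm ℝ F) : Continuous q := by
  have h := ConvexOn.continuousOn isOpen_univ q.convexOn
  exact continuousOn_univ.1 h

theorem Seminorm.exists_norm_le_of_definite {F : Type*} [NormedAddCommGroup F]
    [NormedSpace ℝ F] [FiniteDimensional ℝ F] (q : Seminorm ℝ F) (hq : ∀ w, q w = 0 → w = 0) :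
    ∃ C : ℝ, ∀ w, ‖w‖ ≤ C * q w := by
  rcases subsingleton_or_nontrivial F with h | h
  · exact ⟨0, fun w => by simp [Subsingleton.elim w 0]⟩
  obtain ⟨w₀, hw₀, hmin⟩ := (isCompact_sphere (0 : F) 1).exists_isMinOn
    (NormedSpace.sphere_nonempty.2 zero_le_one) q.continuous_finiteDimensional.continuousOn
  have hw₀' : ‖w₀‖ = 1 := by simpa using hw₀
  have hpos : 0 < q w₀ := lt_of_le_of_ne (apply_nonneg q w₀) fun h0 => by
    rw [hq w₀ h0.symm, norm_zero] at hw₀'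
    exact zero_ne_one hw₀'
  refine ⟨(q w₀)⁻¹, fun w => ?_⟩
  rcases eq_or_ne w 0 with rfl | hw
  · simp
  have hn : 0 < ‖w‖ := norm_pos_iff.2 hw
  have h1 : q w₀ ≤ q (‖w‖⁻¹ • w) := hmin (by
    simp [norm_smul, hn.ne'])
  rw [map_smul_eq_mul, norm_inv, norm_norm] at h1
  rw [inv_mul_eq_div, le_div_iff₀ hpos]
  calc ‖w‖ * q w₀ ≤ ‖w‖ * (‖w‖⁻¹ * q w) := by gcongr
    _ = q w := by field_simp

theorem Seminorm.isCompact_setOf_le_of_definite {F : Type*} [NormedAddCommGroup F]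
    [NormedSpace ℝ F] [FiniteDimensional ℝ F] (q : Seminorm ℝ F) (hq : ∀ w, q w = 0 → w = 0)
    (c : ℝ) : IsCompact {w | q w ≤ c} := by
  have := FiniteDimensional.proper_real F
  obtain ⟨C, hC⟩ := q.exists_norm_le_of_definite hq
  refine Metric.isCompact_of_isClosed_isBounded
    (isClosed_le q.continuous_finiteDimensional continuous_const)
    (isBounded_iff_forall_norm_le.2 ⟨|C| * c, fun w hw => (hC w).trans ?_⟩)
  calc C * q w ≤ |C| * q w := by gcongr; exact le_abs_self C
    _ ≤ |C| * c := by gcongr; exact hw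

/-! ### Reduction to a min-max over fixed compact sets -/

section Reformulation

variable {s n : ℕ} {m r : Fin s → ℕ}

/-- The product of the unit balls of the norms `N k`. -/
def unitBalls (N : ∀ k, Seminorm ℝ (EuclideanSpace ℝ (Fin (m k)))) : Set (ParamSpace m) :=
  {w | ∀ k, N k (w k) ≤ 1}

theorem zero_mem_unitBalls (N : ∀ k, Seminorm ℝ (EuclideanSpace ℝ (Fin (m k)))) :
    (0 : ParamSpace m) ∈ unitBalls N := fun k => by simp

theorem isCompact_unitBalls (N : ∀ k, Seminorm ℝ (EuclideanSpace ℝ (Fin (m k))))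
    (hN : ∀ k w, N k w = 0 → w = 0) : IsCompact (unitBalls N) := by
  have h : IsCompact (Set.univ.pi fun k => {w | N k w ≤ 1}) :=
    isCompact_univ_pi fun k => (N k).isCompact_setOf_le_of_definite (hN k) 1
  convert h.image (PiLp.continuous_toLp 2 (fun k => EuclideanSpace ℝ (Fin (m k)))) using 1
  ext w
  constructor
  · intro hw
    exact ⟨WithLp.ofLp w, fun k _ => hw k, rfl⟩
  · rintro ⟨w', hw', rfl⟩ k
    exact hw' k (Set.mem_univ k)

theorem uncertaintySet_eq_image (N : ∀ k, Seminorm ℝ (EuclideanSpace ℝ (Fin (m k))))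
    (hN : ∀ k w, N k w = 0 → w = 0) (u : ParamSpace m) (δ : ℝ) :
    uncertaintySet N u δ = (fun w => u + δ • w) '' unitBalls N := by
  ext v
  constructor
  · intro hv
    -- For `δ = 0` definiteness of the norms forces `v = u`; otherwise rescale by `δ⁻¹`, whose sign
    -- is harmless because the balls are symmetric.
    rcases eq_or_ne δ 0 with rfl | hδ
    · refine ⟨0, zero_mem_unitBalls N, ?_⟩
      ext k : 1
      have h1 := hv k
      rw [abs_zero] at h1
      have h2 := hN k _ (le_antisymm h1 (apply_nonneg _ _))
      simpa using (sub_eq_zero.1 h2).symm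
    · refine ⟨δ⁻¹ • (v - u), fun k => ?_, by simp [hδ]⟩
      have h1 := hv k
      rw [PiLp.smul_apply, map_smul_eq_mul, norm_inv, Real.norm_eq_abs,
        inv_mul_le_iff₀ (abs_pos.2 hδ), mul_one]
      exact h1
  · rintro ⟨w, hw, rfl⟩ k
    have : N k (δ • w k) ≤ |δ| := by
      rw [map_smul_eq_mul, Real.norm_eq_abs]
      exact mul_le_of_le_one_right (abs_nonneg _) (hw k)
    simpa using this

/-- The objective in which the maximum over `i` in block `k` is replaced by the choice `c.1 k`, and
the uncertain parameter is `u + δ • c.2`. -/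
noncomputable def selectedObjective (f₀ : EuclideanSpace ℝ (Fin n) → ℝ)
    (f : ∀ k : Fin s, Fin (r k) → EuclideanSpace ℝ (Fin (m k)) → EuclideanSpace ℝ (Fin n) → ℝ)
    (c : (∀ k, Fin (r k)) × ParamSpace m) (x : EuclideanSpace ℝ (Fin n))
    (z : PerturbSpace m) : ℝ :=
  f₀ x + ∑ k, f k (c.1 k) (z.fst k + z.snd • c.2 k) x

/-- The worst case `sup_{v ∈ U(u, δ)}` of the objective at `x`. -/
noncomputable def worstCase (f₀ : EuclideanSpace ℝ (Fin n) → ℝ)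
    (f : ∀ k : Fin s, Fin (r k) → EuclideanSpace ℝ (Fin (m k)) → EuclideanSpace ℝ (Fin n) → ℝ)
    (N : ∀ k, Seminorm ℝ (EuclideanSpace ℝ (Fin (m k))))
    (x : EuclideanSpace ℝ (Fin n)) (z : PerturbSpace m) : ℝ :=
  sSup ((fun c => selectedObjective f₀ f c x z) '' (Set.univ ×ˢ unitBalls N))

/-- The min-value function as a real-valued function. -/
noncomputable def realMinValue (X : Set (EuclideanSpace ℝ (Fin n)))
    (f₀ : EuclideanSpace ℝ (Fin n) → ℝ)
    (f : ∀ k : Fin s, Fin (r k) → EuclideanSpace ℝ (Fin (m k)) → EuclideanSpace ℝ (Fin n) → ℝ)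
    (N : ∀ k, Seminorm ℝ (EuclideanSpace ℝ (Fin (m k)))) (z : PerturbSpace m) : ℝ :=
  sInf ((fun x => worstCase f₀ f N x z) '' X)

variable {X : Set (EuclideanSpace ℝ (Fin n))} {f₀ : EuclideanSpace ℝ (Fin n) → ℝ}
  {f : ∀ k : Fin s, Fin (r k) → EuclideanSpace ℝ (Fin (m k)) → EuclideanSpace ℝ (Fin n) → ℝ}
  {N : ∀ k, Seminorm ℝ (EuclideanSpace ℝ (Fin (m k)))}

theorem sum_le_objective (i : ∀ k, Fin (r k)) (u : ParamSpace m) (x : EuclideanSpace ℝ (Fin n)) :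
    f₀ x + ∑ k, f k (i k) (u k) x ≤ objective f₀ f u x :=
  add_le_add_right (Finset.sum_le_sum fun k _ =>
    le_ciSup (f := fun j => f k j (u k) x) (Set.finite_range _).bddAbove (i k)) _

theorem exists_sum_eq_objective (hr : ∀ k, 0 < r k) (f₀ : EuclideanSpace ℝ (Fin n) → ℝ)
    (f : ∀ k : Fin s, Fin (r k) → EuclideanSpace ℝ (Fin (m k)) → EuclideanSpace ℝ (Fin n) → ℝ)
    (u : ParamSpace m) (x : EuclideanSpace ℝ (Fin n)) :
    ∃ i : ∀ k, Fin (r k), f₀ x + ∑ k, f k (i k) (u k) x = objective f₀ f u x := by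
  have h : ∀ k, ∃ i, f k i (u k) x = ⨆ j, f k j (u k) x := fun k => by
    have : Nonempty (Fin (r k)) := ⟨⟨0, hr k⟩⟩
    exact exists_eq_ciSup_of_finite
  choose i hi using h
  exact ⟨i, by simp only [objective, hi]⟩

theorem selectedObjective_le_objective (c : (∀ k, Fin (r k)) × ParamSpace m)
    (x : EuclideanSpace ℝ (Fin n)) (z : PerturbSpace m) :
    selectedObjective f₀ f c x z ≤ objective f₀ f (z.fst + z.snd • c.2) x :=
  sum_le_objective c.1 (z.fst + z.snd • c.2) x

theorem continuous_selectedObjective (hf₀ : Continuous f₀)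
    (hf : ∀ k i, Continuous
      (fun z : EuclideanSpace ℝ (Fin (m k)) × EuclideanSpace ℝ (Fin n) => f k i z.1 z.2)) :
    Continuous fun q : ((∀ k, Fin (r k)) × ParamSpace m) × EuclideanSpace ℝ (Fin n) ×
      PerturbSpace m => selectedObjective f₀ f q.1 q.2.1 q.2.2 := by
  unfold selectedObjective
  refine (hf₀.comp (by fun_prop)).add (continuous_finsetSum _ fun k _ => ?_)
  have h1 : Continuous fun a : Fin (r k) × EuclideanSpace ℝ (Fin (m k)) ×
      EuclideanSpace ℝ (Fin n) => f k a.1 a.2.1 a.2.2 :=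
    continuous_prod_of_discrete_left.2 fun i => hf k i
  have hfst : Continuous fun z : PerturbSpace m => z.fst := WithLp.continuous_fst ..
  have hsnd : Continuous fun z : PerturbSpace m => z.snd := WithLp.continuous_snd ..
  have hfst' : Continuous fun z : PerturbSpace m => z.fst k :=
    (PiLp.continuous_apply 2 _ k).comp hfst
  have h2 : Continuous fun q : ((∀ k, Fin (r k)) × ParamSpace m) × EuclideanSpace ℝ (Fin n) ×
      PerturbSpace m => (q.1.1 k, q.2.2.fst k + q.2.2.snd • q.1.2 k, q.2.1) := by
    refine Continuous.prodMk (by fun_prop) (Continuous.prodMk ?_ (by fun_prop))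
    exact (hfst'.comp (by fun_prop)).add
      ((hsnd.comp (by fun_prop)).smul ((PiLp.continuous_apply 2 _ k).comp (by fun_prop)))
  exact h1.comp h2

theorem isCompact_selections (hN : ∀ k w, N k w = 0 → w = 0) :
    IsCompact ((Set.univ : Set (∀ k, Fin (r k))) ×ˢ unitBalls N) :=
  isCompact_univ.prod (isCompact_unitBalls N hN)

theorem nonempty_selections (hr : ∀ k, 0 < r k) :
    ((Set.univ : Set (∀ k, Fin (r k))) ×ˢ unitBalls N).Nonempty :=
  ⟨(fun k => ⟨0, hr k⟩, 0), Set.mem_univ _, zero_mem_unitBalls N⟩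

/-- The supremum runs over a compact set that depends on neither `x` nor `z`, so joint continuity of
the selected objectives passes to it. -/
theorem continuous_worstCase (hf₀ : Continuous f₀)
    (hf : ∀ k i, Continuous
      (fun z : EuclideanSpace ℝ (Fin (m k)) × EuclideanSpace ℝ (Fin n) => f k i z.1 z.2))
    (hN : ∀ k w, N k w = 0 → w = 0) :
    Continuous fun q : EuclideanSpace ℝ (Fin n) × PerturbSpace m => worstCase f₀ f N q.1 q.2 :=
  IsCompact.continuous_sSup (isCompact_selections hN)
    (f := fun (q : EuclideanSpace ℝ (Fin n) × PerturbSpace m) c =>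
      selectedObjective f₀ f c q.1 q.2)
    ((continuous_selectedObjective hf₀ hf).comp
      (continuous_snd.prodMk continuous_fst))

theorem selectedObjective_le_worstCase (hf₀ : Continuous f₀)
    (hf : ∀ k i, Continuous
      (fun z : EuclideanSpace ℝ (Fin (m k)) × EuclideanSpace ℝ (Fin n) => f k i z.1 z.2))
    (hN : ∀ k w, N k w = 0 → w = 0) {c : (∀ k, Fin (r k)) × ParamSpace m}
    (hc : c.2 ∈ unitBalls N) (x : EuclideanSpace ℝ (Fin n)) (z : PerturbSpace m) :
    selectedObjective f₀ f c x z ≤ worstCase f₀ f N x z := by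
  have hcont : Continuous fun c => selectedObjective f₀ f c x z :=
    (continuous_selectedObjective hf₀ hf).comp
      (continuous_id.prodMk (continuous_const (y := (x, z))))
  exact le_csSup ((isCompact_selections hN).bddAbove_image hcont.continuousOn)
    ⟨c, ⟨Set.mem_univ _, hc⟩, rfl⟩

theorem exists_selectedObjective_eq_worstCase (hr : ∀ k, 0 < r k) (hf₀ : Continuous f₀)
    (hf : ∀ k i, Continuous
      (fun z : EuclideanSpace ℝ (Fin (m k)) × EuclideanSpace ℝ (Fin n) => f k i z.1 z.2))
    (hN : ∀ k w, N k w = 0 → w = 0) (x : EuclideanSpace ℝ (Fin n)) (z : PerturbSpace m) :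
    ∃ c : (∀ k, Fin (r k)) × ParamSpace m, c.2 ∈ unitBalls N ∧
      worstCase f₀ f N x z = selectedObjective f₀ f c x z := by
  have hcont : Continuous fun c => selectedObjective f₀ f c x z :=
    (continuous_selectedObjective hf₀ hf).comp
      (continuous_id.prodMk (continuous_const (y := (x, z))))
  obtain ⟨c, hc, h⟩ := (isCompact_selections hN).exists_sSup_image_eq
    (nonempty_selections hr) hcont.continuousOn
  exact ⟨c, hc.2, h⟩

theorem objective_le_worstCase (hr : ∀ k, 0 < r k) (hf₀ : Continuous f₀)
    (hf : ∀ k i, Continuous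
      (fun z : EuclideanSpace ℝ (Fin (m k)) × EuclideanSpace ℝ (Fin n) => f k i z.1 z.2))
    (hN : ∀ k w, N k w = 0 → w = 0) {w : ParamSpace m} (hw : w ∈ unitBalls N)
    (x : EuclideanSpace ℝ (Fin n)) (z : PerturbSpace m) :
    objective f₀ f (z.fst + z.snd • w) x ≤ worstCase f₀ f N x z := by
  obtain ⟨i, hi⟩ := exists_sum_eq_objective hr f₀ f (z.fst + z.snd • w) x
  rw [← hi]
  exact selectedObjective_le_worstCase hf₀ hf hN (c := (i, w)) hw x z

theorem worstCase_eq_objective (hr : ∀ k, 0 < r k) (hf₀ : Continuous f₀)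
    (hf : ∀ k i, Continuous
      (fun z : EuclideanSpace ℝ (Fin (m k)) × EuclideanSpace ℝ (Fin n) => f k i z.1 z.2))
    (hN : ∀ k w, N k w = 0 → w = 0) (x : EuclideanSpace ℝ (Fin n)) (u : ParamSpace m) :
    worstCase f₀ f N x (WithLp.toLp 2 (u, 0)) = objective f₀ f u x := by
  apply le_antisymm
  · obtain ⟨c, hc, h⟩ := exists_selectedObjective_eq_worstCase hr hf₀ hf hN x
      (WithLp.toLp 2 (u, (0 : ℝ)))
    rw [h]
    simpa using selectedObjective_le_objective (f₀ := f₀) (f := f) c x (WithLp.toLp 2 (u, (0 : ℝ)))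
  · simpa using objective_le_worstCase hr hf₀ hf hN (zero_mem_unitBalls N) x
      (WithLp.toLp 2 (u, (0 : ℝ)))

theorem iSup_uncertaintySet_eq_worstCase (hr : ∀ k, 0 < r k) (hf₀ : Continuous f₀)
    (hf : ∀ k i, Continuous
      (fun z : EuclideanSpace ℝ (Fin (m k)) × EuclideanSpace ℝ (Fin n) => f k i z.1 z.2))
    (hN : ∀ k w, N k w = 0 → w = 0) (x : EuclideanSpace ℝ (Fin n)) (z : PerturbSpace m) :
    (⨆ v ∈ uncertaintySet N z.fst z.snd, ((objective f₀ f v x : ℝ) : EReal)) =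
      (worstCase f₀ f N x z : ℝ) := by
  rw [uncertaintySet_eq_image N hN]
  apply le_antisymm
  · refine iSup₂_le ?_
    rintro _ ⟨w, hw, rfl⟩
    exact EReal.coe_le_coe_iff.2 (objective_le_worstCase hr hf₀ hf hN hw x z)
  · obtain ⟨c, hc, h⟩ := exists_selectedObjective_eq_worstCase hr hf₀ hf hN x z
    rw [h]
    exact (EReal.coe_le_coe_iff.2 (selectedObjective_le_objective c x z)).trans
      (le_iSup₂_of_le (z.fst + z.snd • c.2) ⟨c.2, hc, rfl⟩ le_rfl)

theorem realMinValue_le (hXc : IsCompact X) (hf₀ : Continuous f₀)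
    (hf : ∀ k i, Continuous
      (fun z : EuclideanSpace ℝ (Fin (m k)) × EuclideanSpace ℝ (Fin n) => f k i z.1 z.2))
    (hN : ∀ k w, N k w = 0 → w = 0) {x : EuclideanSpace ℝ (Fin n)} (hx : x ∈ X)
    (z : PerturbSpace m) : realMinValue X f₀ f N z ≤ worstCase f₀ f N x z := by
  have hcont : Continuous fun x => worstCase f₀ f N x z :=
    (continuous_worstCase hf₀ hf hN).comp (continuous_id.prodMk continuous_const)
  exact csInf_le (hXc.bddBelow_image hcont.continuousOn) ⟨x, hx, rfl⟩

theorem exists_realMinValue_eq (hXne : X.Nonempty) (hXc : IsCompact X) (hf₀ : Continuous f₀)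
    (hf : ∀ k i, Continuous
      (fun z : EuclideanSpace ℝ (Fin (m k)) × EuclideanSpace ℝ (Fin n) => f k i z.1 z.2))
    (hN : ∀ k w, N k w = 0 → w = 0) (z : PerturbSpace m) :
    ∃ x ∈ X, realMinValue X f₀ f N z = worstCase f₀ f N x z := by
  have hcont : Continuous fun x => worstCase f₀ f N x z :=
    (continuous_worstCase hf₀ hf hN).comp (continuous_id.prodMk continuous_const)
  exact hXc.exists_sInf_image_eq hXne hcont.continuousOn

theorem minValue_eq_coe (hr : ∀ k, 0 < r k) (hXne : X.Nonempty) (hXc : IsCompact X)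
    (hf₀ : Continuous f₀)
    (hf : ∀ k i, Continuous
      (fun z : EuclideanSpace ℝ (Fin (m k)) × EuclideanSpace ℝ (Fin n) => f k i z.1 z.2))
    (hN : ∀ k w, N k w = 0 → w = 0) (z : PerturbSpace m) :
    minValue X f₀ f N z = (realMinValue X f₀ f N z : ℝ) := by
  unfold minValue
  simp only [iSup_uncertaintySet_eq_worstCase hr hf₀ hf hN]
  apply le_antisymm
  · obtain ⟨x, hx, h⟩ := exists_realMinValue_eq hXne hXc hf₀ hf hN z
    rw [h]
    exact iInf₂_le x hx
  · exact le_iInf₂ fun x hx => EReal.coe_le_coe_iff.2 (realMinValue_le hXc hf₀ hf hN hx z)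

/-- Optimality of `xs j` at `zs j` is an inequality between jointly continuous worst cases, so it
survives the limit; at `δ = 0` the worst case is the nominal objective. -/
theorem mem_nominalMinimizers_of_tendsto (hr : ∀ k, 0 < r k) (hXc : IsCompact X)
    (hf₀ : Continuous f₀)
    (hf : ∀ k i, Continuous
      (fun z : EuclideanSpace ℝ (Fin (m k)) × EuclideanSpace ℝ (Fin n) => f k i z.1 z.2))
    (hN : ∀ k w, N k w = 0 → w = 0) {ubar : ParamSpace m} {xs : ℕ → EuclideanSpace ℝ (Fin n)}
    {zs : ℕ → PerturbSpace m} {x : EuclideanSpace ℝ (Fin n)} (hxX : ∀ j, xs j ∈ X)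
    (hmin : ∀ j, realMinValue X f₀ f N (zs j) = worstCase f₀ f N (xs j) (zs j))
    (hx : Tendsto xs atTop (𝓝 x)) (hz : Tendsto zs atTop (𝓝 (WithLp.toLp 2 (ubar, 0)))) :
    x ∈ nominalMinimizers X f₀ f ubar := by
  refine ⟨hXc.isClosed.mem_of_tendsto hx (Eventually.of_forall hxX), fun x' hx' => ?_⟩
  have hc := continuous_worstCase (N := N) hf₀ hf hN
  have h1 := (hc.tendsto (x, WithLp.toLp 2 (ubar, 0))).comp (hx.prodMk_nhds hz)
  have h2 := (hc.tendsto (x', WithLp.toLp 2 (ubar, 0))).comp (tendsto_const_nhds.prodMk_nhds hz)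
  have h3 := le_of_tendsto_of_tendsto' h1 h2 fun j => by
    simp only [Function.comp_apply]
    rw [← hmin j]
    exact realMinValue_le hXc hf₀ hf hN hx' (zs j)
  simp only [worstCase_eq_objective hr hf₀ hf hN] at h3
  exact h3

theorem nonempty_nominalMinimizers (hr : ∀ k, 0 < r k) (hXne : X.Nonempty) (hXc : IsCompact X)
    (hf₀ : Continuous f₀)
    (hf : ∀ k i, Continuous
      (fun z : EuclideanSpace ℝ (Fin (m k)) × EuclideanSpace ℝ (Fin n) => f k i z.1 z.2))
    (hN : ∀ k w, N k w = 0 → w = 0) (ubar : ParamSpace m) :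
    (nominalMinimizers X f₀ f ubar).Nonempty := by
  obtain ⟨x, hx, h⟩ := exists_realMinValue_eq hXne hXc hf₀ hf hN (WithLp.toLp 2 (ubar, 0))
  exact ⟨x, mem_nominalMinimizers_of_tendsto hr hXc hf₀ hf hN (xs := fun _ => x)
    (zs := fun _ => WithLp.toLp 2 (ubar, 0)) (fun _ => hx) (fun _ => h) tendsto_const_nhds
    tendsto_const_nhds⟩

theorem isCompact_nominalMinimizers {ubar : ParamSpace m} (hXc : IsCompact X)
    (hobj : Continuous (objective f₀ f ubar)) :
    IsCompact (nominalMinimizers X f₀ f ubar) := by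
  have h : nominalMinimizers X f₀ f ubar =
      X ∩ {x | ∀ x' ∈ X, objective f₀ f ubar x ≤ objective f₀ f ubar x'} := rfl
  rw [h]
  refine hXc.inter_right ?_
  simp only [Set.ofPred_forall]
  exact isClosed_iInter fun x' => isClosed_iInter fun _ => isClosed_le hobj continuous_const

end Reformulation

/-! ### Limits of difference quotients of the worst case -/

/-- Both endpoints `a j` and `b j` move, so strict differentiability is the right notion: the error
is `o(a j - b j)`, and convergence of the quotients makes `a j - b j = O(t j)`. -/
theorem HasStrictFDerivAt.tendsto_quotient {α F G : Type*} [NormedAddCommGroup F] [NormedSpace ℝ F]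
    [NormedAddCommGroup G] [NormedSpace ℝ G] {g : F → G} {g' : F →L[ℝ] G} {p : F}
    (hg : HasStrictFDerivAt g g' p) {l : Filter α} {a b : α → F} {t : α → ℝ} {d : F}
    (ha : Tendsto a l (𝓝 p)) (hb : Tendsto b l (𝓝 p)) (ht : ∀ j, t j ≠ 0)
    (hd : Tendsto (fun j => (t j)⁻¹ • (a j - b j)) l (𝓝 d)) :
    Tendsto (fun j => (t j)⁻¹ • (g (a j) - g (b j))) l (𝓝 (g' d)) := by
  have h1 : (fun j => g (a j) - g (b j) - g' (a j - b j)) =o[l] fun j => a j - b j :=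
    hg.isLittleO.comp_tendsto (ha.prodMk_nhds hb)
  have h2 : (fun j => a j - b j) =O[l] t := by
    have h := (Asymptotics.isBigO_refl t l).smul (hd.isBigO_one ℝ)
    simpa [ht] using h
  have h3 := (h1.trans_isBigO h2).tendsto_inv_smul_nhds_zero
  have h4 := h3.add ((g'.continuous.tendsto d).comp hd)
  rw [zero_add] at h4
  refine h4.congr fun j => ?_
  simp only [Function.comp_apply, map_smul]
  rw [← smul_add, sub_add_cancel]

section Gradient

variable {s n : ℕ} {m r : Fin s → ℕ}
  {f : ∀ k : Fin s, Fin (r k) → EuclideanSpace ℝ (Fin (m k)) → EuclideanSpace ℝ (Fin n) → ℝ}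

/-- Expressing the partial gradient through the joint derivative gives its continuity in `x` and
links it to strict differentiability in the pair. -/
theorem grad₁_eq_toDual_symm {k : Fin s} {i : Fin (r k)}
    (hf : ContDiff ℝ 1
      (fun z : EuclideanSpace ℝ (Fin (m k)) × EuclideanSpace ℝ (Fin n) => f k i z.1 z.2))
    (ubar : ParamSpace m) (x : EuclideanSpace ℝ (Fin n)) :
    grad₁ f ubar k i x = (InnerProductSpace.toDual ℝ _).symm
      ((fderiv ℝ (fun z : EuclideanSpace ℝ (Fin (m k)) × EuclideanSpace ℝ (Fin n) =>
        f k i z.1 z.2) (ubar k, x)).comp (ContinuousLinearMap.inl ℝ _ _)) := by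
  have h1 : HasFDerivAt (fun z : EuclideanSpace ℝ (Fin (m k)) × EuclideanSpace ℝ (Fin n) =>
      f k i z.1 z.2) _ (ubar k, x) :=
    (hf.differentiable one_ne_zero (ubar k, x)).hasFDerivAt
  have h2 := h1.comp (ubar k) (hasFDerivAt_prodMk_left (𝕜 := ℝ) (ubar k) x)
  unfold grad₁ gradient
  congr 1
  exact h2.fderiv

theorem inner_grad₁ {k : Fin s} {i : Fin (r k)}
    (hf : ContDiff ℝ 1
      (fun z : EuclideanSpace ℝ (Fin (m k)) × EuclideanSpace ℝ (Fin n) => f k i z.1 z.2))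
    (ubar : ParamSpace m) (x : EuclideanSpace ℝ (Fin n)) (h : EuclideanSpace ℝ (Fin (m k))) :
    inner ℝ (grad₁ f ubar k i x) h =
      fderiv ℝ (fun z : EuclideanSpace ℝ (Fin (m k)) × EuclideanSpace ℝ (Fin n) =>
        f k i z.1 z.2) (ubar k, x) (h, 0) := by
  rw [grad₁_eq_toDual_symm hf, InnerProductSpace.toDual_symm_apply]
  simp

theorem continuous_grad₁ {k : Fin s} {i : Fin (r k)}
    (hf : ContDiff ℝ 1
      (fun z : EuclideanSpace ℝ (Fin (m k)) × EuclideanSpace ℝ (Fin n) => f k i z.1 z.2))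
    (ubar : ParamSpace m) : Continuous (grad₁ f ubar k i) := by
  rw [funext (grad₁_eq_toDual_symm hf ubar)]
  refine (LinearIsometryEquiv.continuous _).comp ?_
  have h := (hf.continuous_fderiv one_ne_zero).comp
    (Continuous.prodMk (continuous_const (y := ubar k)) continuous_id)
  exact h.clm_comp continuous_const

theorem mem_activeIndices_iff {ubar : ParamSpace m} {k : Fin s} {i : Fin (r k)}
    {x : EuclideanSpace ℝ (Fin n)} :
    i ∈ activeIndices f ubar k x ↔ ∀ j, f k j (ubar k) x ≤ f k i (ubar k) x := by
  have hb : BddAbove (Set.range fun j => f k j (ubar k) x) := (Set.finite_range _).bddAbove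
  simp only [activeIndices, Finset.mem_filter, Finset.mem_univ, true_and]
  constructor
  · intro h j
    rw [h]
    exact le_ciSup hb j
  · intro h
    have : Nonempty (Fin (r k)) := ⟨i⟩
    exact le_antisymm (le_ciSup hb i) (ciSup_le h)

end Gradient

section Quotient

variable {s n : ℕ} {m r : Fin s → ℕ} {f₀ : EuclideanSpace ℝ (Fin n) → ℝ}
  {f : ∀ k : Fin s, Fin (r k) → EuclideanSpace ℝ (Fin (m k)) → EuclideanSpace ℝ (Fin n) → ℝ}
  {N : ∀ k, Seminorm ℝ (EuclideanSpace ℝ (Fin (m k)))}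

/-- A maximizing selection for the worst case is maximizing block by block. -/
theorem le_of_worstCase_eq (hf₀ : Continuous f₀)
    (hf : ∀ k i, Continuous
      (fun z : EuclideanSpace ℝ (Fin (m k)) × EuclideanSpace ℝ (Fin n) => f k i z.1 z.2))
    (hN : ∀ k w, N k w = 0 → w = 0) {c : (∀ k, Fin (r k)) × ParamSpace m}
    (hc : c.2 ∈ unitBalls N) {x : EuclideanSpace ℝ (Fin n)} {z : PerturbSpace m}
    (h : worstCase f₀ f N x z = selectedObjective f₀ f c x z) (k : Fin s) (i : Fin (r k)) :
    f k i (z.fst k + z.snd • c.2 k) x ≤ f k (c.1 k) (z.fst k + z.snd • c.2 k) x := by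
  -- Change the index in block `k` alone, keeping `c.2`: all other blocks cancel in the comparison.
  have h1 := selectedObjective_le_worstCase hf₀ hf hN (c := (Function.update c.1 k i, c.2)) hc x z
  rw [h] at h1
  unfold selectedObjective at h1
  have h2 : ∑ k', f k' (Function.update c.1 k i k') (z.fst k' + z.snd • c.2 k') x =
      f k i (z.fst k + z.snd • c.2 k) x +
        ∑ k' ∈ Finset.univ.erase k, f k' (c.1 k') (z.fst k' + z.snd • c.2 k') x := by
    rw [← Finset.add_sum_erase _ _ (Finset.mem_univ k), Function.update_self]
    congr 1
    refine Finset.sum_congr rfl fun k' hk' => ?_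
    rw [Function.update_of_ne (Finset.ne_of_mem_erase hk')]
  rw [h2, ← Finset.add_sum_erase Finset.univ
    (fun k' => f k' (c.1 k') (z.fst k' + z.snd • c.2 k') x) (Finset.mem_univ k)] at h1
  linarith

/-- A selection that is worst at `zs j` is still admissible at `zs' j`, so the difference of worst
cases is at most the increment of that one selected objective. Along a subsequence the selections
converge and the increments are differentiated termwise. -/
theorem exists_le_sum_inner_of_quotient (hr : ∀ k, 0 < r k) (hf₀ : Continuous f₀)
    (hf : ∀ k i, ContDiff ℝ 1
      (fun z : EuclideanSpace ℝ (Fin (m k)) × EuclideanSpace ℝ (Fin n) => f k i z.1 z.2))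
    (hN : ∀ k w, N k w = 0 → w = 0) {ubar : ParamSpace m} {xs : ℕ → EuclideanSpace ℝ (Fin n)}
    {zs zs' : ℕ → PerturbSpace m} {x : EuclideanSpace ℝ (Fin n)} {t : ℕ → ℝ}
    {d : PerturbSpace m} {bs : ℕ → ℝ} {b : ℝ}
    (hx : Tendsto xs atTop (𝓝 x)) (hz : Tendsto zs atTop (𝓝 (WithLp.toLp 2 (ubar, 0))))
    (hz' : Tendsto zs' atTop (𝓝 (WithLp.toLp 2 (ubar, 0)))) (ht : ∀ j, 0 < t j)
    (hd : Tendsto (fun j => (t j)⁻¹ • (zs j - zs' j)) atTop (𝓝 d))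
    (hb : Tendsto bs atTop (𝓝 b))
    (hle : ∀ j, t j * bs j ≤ worstCase f₀ f N (xs j) (zs j) - worstCase f₀ f N (xs j) (zs' j)) :
    ∃ (i : ∀ k, Fin (r k)) (w : ParamSpace m), (∀ k, i k ∈ activeIndices f ubar k x) ∧
      w ∈ unitBalls N ∧
      b ≤ ∑ k, inner ℝ (grad₁ f ubar k (i k) x) (d.fst k + d.snd • w k) := by
  have hfc := fun k i => (hf k i).continuous
  choose c hc hcval using fun j =>
    exists_selectedObjective_eq_worstCase hr hf₀ hfc hN (xs j) (zs j)
  obtain ⟨⟨i, w⟩, ⟨-, hw⟩, φ, hφ, hcφ⟩ := (isCompact_selections (r := r) hN).tendsto_subseq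
    (x := c) fun j => ⟨Set.mem_univ _, hc j⟩
  have hφ' := hφ.tendsto_atTop
  have hfst : Continuous fun z : PerturbSpace m => z.fst := WithLp.continuous_fst ..
  have hsnd : Continuous fun z : PerturbSpace m => z.snd := WithLp.continuous_snd ..
  have hap : ∀ k, Continuous fun v : ParamSpace m => v k := fun k => PiLp.continuous_apply 2 _ k
  -- The index choices live in a discrete space, so convergence means being eventually constant.
  have hci : ∀ᶠ j in atTop, (c (φ j)).1 = i := by
    have := (continuous_fst.tendsto (i, w)).comp hcφ
    rw [nhds_discrete] at this
    exact tendsto_pure.1 this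
  have hcw : ∀ k, Tendsto (fun j => (c (φ j)).2 k) atTop (𝓝 (w k)) := fun k =>
    (((hap k).comp continuous_snd).tendsto (i, w)).comp hcφ
  -- The limit does not involve `w`, because `δ → 0` while the `w`-parts converge.
  have hpt : ∀ ys : ℕ → PerturbSpace m, Tendsto ys atTop (𝓝 (WithLp.toLp 2 (ubar, 0))) →
      ∀ k, Tendsto (fun j => ((ys (φ j)).fst k + (ys (φ j)).snd • (c (φ j)).2 k, xs (φ j))) atTop
        (𝓝 (ubar k, x)) := by
    intro ys hys k
    have h1 := (((hap k).comp hfst).tendsto _).comp (hys.comp hφ')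
    have h2 := (hsnd.tendsto _).comp (hys.comp hφ')
    have h3 := h1.add (h2.smul (hcw k))
    simp only [Function.comp_def, WithLp.toLp_fst, WithLp.toLp_snd, zero_smul, add_zero] at h3
    exact h3.prodMk_nhds (hx.comp hφ')
  have hquot : ∀ k, Tendsto (fun j => (t (φ j))⁻¹ •
      (f k (i k) ((zs (φ j)).fst k + (zs (φ j)).snd • (c (φ j)).2 k) (xs (φ j)) -
        f k (i k) ((zs' (φ j)).fst k + (zs' (φ j)).snd • (c (φ j)).2 k) (xs (φ j)))) atTop
      (𝓝 (inner ℝ (grad₁ f ubar k (i k) x) (d.fst k + d.snd • w k))) := by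
    intro k
    have key := HasStrictFDerivAt.tendsto_quotient (g := fun z : EuclideanSpace ℝ (Fin (m k)) ×
      EuclideanSpace ℝ (Fin n) => f k (i k) z.1 z.2)
      -- The second component vanishes because both endpoints share the same `xs (φ j)`.
      (d := (d.fst k + d.snd • w k, 0)) (t := fun j => t (φ j))
      ((hf k (i k)).hasStrictFDerivAt (x := (ubar k, x)) one_ne_zero)
      (hpt zs hz k) (hpt zs' hz' k) (fun j => (ht (φ j)).ne')
    rw [← inner_grad₁ (hf k (i k))] at key
    refine key ?_
    have h1 := (((hap k).comp hfst).tendsto _).comp (hd.comp hφ')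
    have h2 := (hsnd.tendsto _).comp (hd.comp hφ')
    have h3 := (h1.add (h2.smul (hcw k))).prodMk_nhds
      (tendsto_const_nhds (x := (0 : EuclideanSpace ℝ (Fin n))))
    refine h3.congr fun j => ?_
    ext1
    · simp only [Function.comp_apply, WithLp.smul_fst, WithLp.sub_fst, PiLp.smul_apply,
        PiLp.sub_apply, WithLp.smul_snd, WithLp.sub_snd, Prod.smul_fst, Prod.fst_sub, smul_eq_mul]
      module
    · simp
  refine ⟨i, w, fun k => mem_activeIndices_iff.2 fun i' => ?_, hw, ?_⟩
  · have h1 := ((hfc k i').tendsto _).comp (hpt zs hz k)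
    have h2 := ((hfc k (i k)).tendsto _).comp (hpt zs hz k)
    refine le_of_tendsto_of_tendsto h1 h2 ?_
    filter_upwards [hci] with j hj
    have := le_of_worstCase_eq hf₀ hfc hN (hc (φ j)) (hcval (φ j)) k i'
    rwa [hj] at this
  · refine le_of_tendsto_of_tendsto (hb.comp hφ') (tendsto_finsetSum Finset.univ fun k _ => hquot k)
      ?_
    filter_upwards [hci] with j hj
    have h1 := hle (φ j)
    have h2 := selectedObjective_le_worstCase hf₀ hfc hN (hc (φ j)) (xs (φ j)) (zs' (φ j))
    rw [hcval (φ j)] at h1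
    unfold selectedObjective at h1 h2
    rw [hj] at h1 h2
    simp only [Function.comp_apply, smul_eq_mul]
    rw [← Finset.mul_sum, Finset.sum_sub_distrib, le_inv_mul_iff₀ (ht _)]
    linarith

end Quotient

section Modulus

variable {s n : ℕ} {m r : Fin s → ℕ} {X : Set (EuclideanSpace ℝ (Fin n))}
  {f₀ : EuclideanSpace ℝ (Fin n) → ℝ}
  {f : ∀ k : Fin s, Fin (r k) → EuclideanSpace ℝ (Fin (m k)) → EuclideanSpace ℝ (Fin n) → ℝ}
  {N : ∀ k, Seminorm ℝ (EuclideanSpace ℝ (Fin (m k)))}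

/-! ### The bound on the Lipschitz modulus -/

theorem isGreatest_termValues (hN : ∀ k w, N k w = 0 → w = 0) (ubar : ParamSpace m) (k : Fin s)
    (i : Fin (r k)) (x : EuclideanSpace ℝ (Fin n)) :
    IsGreatest (termValues f N ubar k i x) (sSup (termValues f N ubar k i x)) := by
  have hc : IsCompact (termValues f N ubar k i x) :=
    ((N k).isCompact_setOf_le_of_definite (hN k) 1).image (by fun_prop)
  exact hc.isGreatest_sSup ⟨_, 0, by simp, rfl⟩

theorem sSup_termValues_nonneg (ubar : ParamSpace m) (k : Fin s)
    (i : Fin (r k)) (x : EuclideanSpace ℝ (Fin n)) : 0 ≤ sSup (termValues f N ubar k i x) := by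
  refine Real.sSup_nonneg ?_
  rintro _ ⟨w, _, rfl⟩
  exact Real.sqrt_nonneg _

theorem continuous_sSup_termValues (hN : ∀ k w, N k w = 0 → w = 0) {k : Fin s} {i : Fin (r k)}
    (hf : ContDiff ℝ 1
      (fun z : EuclideanSpace ℝ (Fin (m k)) × EuclideanSpace ℝ (Fin n) => f k i z.1 z.2))
    (ubar : ParamSpace m) : Continuous fun x => sSup (termValues f N ubar k i x) := by
  have hg := continuous_grad₁ hf ubar
  refine IsCompact.continuous_sSup ((N k).isCompact_setOf_le_of_definite (hN k) 1)
    (f := fun x w => √(‖grad₁ f ubar k i x‖ ^ 2 + (inner ℝ (grad₁ f ubar k i x) w) ^ 2)) ?_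
  have hg' := hg.comp (continuous_fst (X := EuclideanSpace ℝ (Fin n))
    (Y := EuclideanSpace ℝ (Fin (m k))))
  exact (((hg'.norm.pow 2).add ((hg'.inner continuous_snd).pow 2)).sqrt)

/-- An index inactive at `x` stays inactive nearby, and losing an active index only removes a
nonnegative term. -/
theorem upperSemicontinuous_sum_sSup_termValues (hN : ∀ k w, N k w = 0 → w = 0)
    (hf : ∀ k i, ContDiff ℝ 1
      (fun z : EuclideanSpace ℝ (Fin (m k)) × EuclideanSpace ℝ (Fin n) => f k i z.1 z.2))
    (ubar : ParamSpace m) :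
    UpperSemicontinuous fun x =>
      ∑ k, ∑ i ∈ activeIndices f ubar k x, sSup (termValues f N ubar k i x) := by
  classical
  have h : (fun x => ∑ k, ∑ i ∈ activeIndices f ubar k x, sSup (termValues f N ubar k i x)) =
      fun x => ∑ k, ∑ i, if i ∈ activeIndices f ubar k x then sSup (termValues f N ubar k i x)
        else 0 := by
    funext x
    refine Finset.sum_congr rfl fun k _ => ?_
    rw [← Finset.sum_filter]
    congr 1
    ext i
    simp
  rw [h]
  refine upperSemicontinuous_sum fun k _ => upperSemicontinuous_sum fun i _ => ?_
  have hclosed : IsClosed {x | i ∈ activeIndices f ubar k x} := by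
    have hfc : ∀ j, Continuous fun x => f k j (ubar k) x := fun j =>
      (hf k j).continuous.comp (Continuous.prodMk continuous_const continuous_id)
    simp only [mem_activeIndices_iff, Set.ofPred_forall]
    exact isClosed_iInter fun j => isClosed_le (hfc j) (hfc i)
  intro x y hy
  by_cases hx : i ∈ activeIndices f ubar k x
  · simp only [hx, if_true] at hy
    have hy0 := (sSup_termValues_nonneg (f := f) (N := N) ubar k i x).trans_lt hy
    filter_upwards [(continuous_sSup_termValues hN (hf k i) ubar).tendsto x (Iio_mem_nhds hy)]
      with x' hx'
    split_ifs
    · exact hx'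
    · exact hy0
  · simp only [hx, if_false] at hy
    filter_upwards [hclosed.isOpen_compl.mem_nhds hx] with x' hx'
    rw [if_neg (show i ∉ activeIndices f ubar k x' from hx')]
    exact hy

theorem continuous_objective (hr : ∀ k, 0 < r k) (hf₀ : Continuous f₀)
    (hf : ∀ k i, Continuous
      (fun z : EuclideanSpace ℝ (Fin (m k)) × EuclideanSpace ℝ (Fin n) => f k i z.1 z.2))
    (hN : ∀ k w, N k w = 0 → w = 0) (ubar : ParamSpace m) :
    Continuous (objective f₀ f ubar) := by
  have h := (continuous_worstCase hf₀ hf hN).comp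
    (Continuous.prodMk continuous_id (continuous_const (y := WithLp.toLp 2 (ubar, (0 : ℝ)))))
  simp only [Function.comp_def, worstCase_eq_objective hr hf₀ hf hN] at h
  exact h

theorem exists_isGreatest_sum_sSup_termValues (hr : ∀ k, 0 < r k) (hXne : X.Nonempty)
    (hXc : IsCompact X) (hf₀ : Continuous f₀)
    (hf : ∀ k i, ContDiff ℝ 1
      (fun z : EuclideanSpace ℝ (Fin (m k)) × EuclideanSpace ℝ (Fin n) => f k i z.1 z.2))
    (hN : ∀ k w, N k w = 0 → w = 0) (ubar : ParamSpace m) :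
    ∃ x ∈ nominalMinimizers X f₀ f ubar, ∀ x' ∈ nominalMinimizers X f₀ f ubar,
      ∑ k, ∑ i ∈ activeIndices f ubar k x', sSup (termValues f N ubar k i x') ≤
        ∑ k, ∑ i ∈ activeIndices f ubar k x, sSup (termValues f N ubar k i x) := by
  have hfc := fun k i => (hf k i).continuous
  obtain ⟨x, hx, h⟩ := UpperSemicontinuousOn.exists_isMaxOn
    (nonempty_nominalMinimizers hr hXne hXc hf₀ hfc hN ubar)
    (isCompact_nominalMinimizers hXc (continuous_objective hr hf₀ hfc hN ubar))
    ((upperSemicontinuous_sum_sSup_termValues hN hf ubar).upperSemicontinuousOn _)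
  exact ⟨x, hx, h⟩

/-- This is Cauchy–Schwarz in the plane for `(‖a‖, ⟪a, w⟫)` and `(‖h‖, τ)`, after bounding `⟪a, h⟫`
by `‖a‖ * ‖h‖`. -/
theorem inner_add_smul_le_sqrt {F : Type*} [NormedAddCommGroup F] [InnerProductSpace ℝ F]
    (a h w : F) (τ : ℝ) (hτ : ‖h‖ ^ 2 + τ ^ 2 ≤ 1) :
    inner ℝ a (h + τ • w) ≤ √(‖a‖ ^ 2 + (inner ℝ a w) ^ 2) := by
  rw [inner_add_right, inner_smul_right]
  refine Real.le_sqrt_of_sq_le ?_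
  have h1 := abs_real_inner_le_norm a h
  set p := inner ℝ a w
  set q := inner ℝ a h
  have h2 : q + τ * p ≤ ‖a‖ * ‖h‖ + τ * p := by linarith [le_abs_self q]
  have h3 : q ^ 2 ≤ (‖a‖ * ‖h‖) ^ 2 :=
    sq_le_sq' (by linarith [neg_abs_le q]) (by linarith [le_abs_self q])
  have h4 : 2 * (q * (τ * p)) ≤ 2 * ((‖a‖ * ‖h‖) * |τ * p|) := by
    have : q * (τ * p) ≤ |q| * |τ * p| := (le_abs_self _).trans (abs_mul _ _).le
    have : |q| * |τ * p| ≤ (‖a‖ * ‖h‖) * |τ * p| := by gcongr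
    linarith
  have h5 : 2 * ((‖a‖ * ‖h‖) * |τ * p|) ≤ ‖a‖ ^ 2 * τ ^ 2 + p ^ 2 * ‖h‖ ^ 2 := by
    rw [abs_mul]
    nlinarith [sq_nonneg (‖a‖ * |τ| - |p| * ‖h‖), sq_abs τ, sq_abs p]
  have h6 : (‖a‖ ^ 2 + p ^ 2) * (‖h‖ ^ 2 + τ ^ 2) ≤ ‖a‖ ^ 2 + p ^ 2 :=
    mul_le_of_le_one_right (by positivity) hτ
  nlinarith

/-- Each block uses one active index; the other active terms are nonnegative and are simply added.
-/
theorem sum_inner_le_sum_sSup_termValues (hN : ∀ k w, N k w = 0 → w = 0) {ubar : ParamSpace m}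
    {x : EuclideanSpace ℝ (Fin n)} {i : ∀ k, Fin (r k)} {w : ParamSpace m} {d : PerturbSpace m}
    (hi : ∀ k, i k ∈ activeIndices f ubar k x) (hw : w ∈ unitBalls N) (hd : ‖d‖ ≤ 1) :
    ∑ k, inner ℝ (grad₁ f ubar k (i k) x) (d.fst k + d.snd • w k) ≤
      ∑ k, ∑ i ∈ activeIndices f ubar k x, sSup (termValues f N ubar k i x) := by
  refine Finset.sum_le_sum fun k _ => ?_
  have h1 : ‖d.fst k‖ ^ 2 + d.snd ^ 2 ≤ 1 := by
    have h2 : ‖d‖ ^ 2 = ‖d.fst‖ ^ 2 + ‖d.snd‖ ^ 2 := WithLp.prod_norm_sq_eq_of_L2 d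
    have h3 : ‖d.fst k‖ ≤ ‖d.fst‖ := PiLp.norm_apply_le d.fst k
    have h4 : ‖d.fst k‖ ^ 2 ≤ ‖d.fst‖ ^ 2 := by gcongr
    have h5 : ‖d‖ ^ 2 ≤ 1 := pow_le_one₀ (norm_nonneg d) hd
    rw [Real.norm_eq_abs, sq_abs] at h2
    linarith
  calc inner ℝ (grad₁ f ubar k (i k) x) (d.fst k + d.snd • w k)
      ≤ √(‖grad₁ f ubar k (i k) x‖ ^ 2 + (inner ℝ (grad₁ f ubar k (i k) x) (w k)) ^ 2) :=
        inner_add_smul_le_sqrt _ _ _ _ h1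
    _ ≤ sSup (termValues f N ubar k (i k) x) :=
        (isGreatest_termValues hN ubar k (i k) x).2 ⟨w k, hw k, rfl⟩
    _ ≤ ∑ i ∈ activeIndices f ubar k x, sSup (termValues f N ubar k i x) :=
        Finset.single_le_sum (f := fun i => sSup (termValues f N ubar k i x))
          (fun i _ => sSup_termValues_nonneg ubar k i x) (hi k)

/-- If the estimate failed on every ball, pairs `z j`, `z' j` with quotients above `κ` would tend to
`(ubar, 0)`, and the limit of their quotients would give `κ ≤ B`. -/
theorem exists_lipschitz_realMinValue (hr : ∀ k, 0 < r k) (hXne : X.Nonempty)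
    (hXc : IsCompact X) (hf₀ : Continuous f₀)
    (hf : ∀ k i, ContDiff ℝ 1
      (fun z : EuclideanSpace ℝ (Fin (m k)) × EuclideanSpace ℝ (Fin n) => f k i z.1 z.2))
    (hN : ∀ k w, N k w = 0 → w = 0) {ubar : ParamSpace m} {B κ : ℝ}
    (hB : ∀ x ∈ nominalMinimizers X f₀ f ubar,
      ∑ k, ∑ i ∈ activeIndices f ubar k x, sSup (termValues f N ubar k i x) ≤ B) (hκ : B < κ) :
    ∃ ε : ℝ, 0 < ε ∧ ∀ z z' : PerturbSpace m, ‖z - WithLp.toLp 2 (ubar, 0)‖ ≤ ε →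
      ‖z' - WithLp.toLp 2 (ubar, 0)‖ ≤ ε →
        |realMinValue X f₀ f N z - realMinValue X f₀ f N z'| ≤ κ * ‖z - z'‖ := by
  have hfc := fun k i => (hf k i).continuous
  by_contra! hcon
  have hcon' : ∀ j : ℕ, ∃ z z' : PerturbSpace m,
      ‖z - WithLp.toLp 2 (ubar, 0)‖ ≤ 1 / ((j : ℝ) + 1) ∧
      ‖z' - WithLp.toLp 2 (ubar, 0)‖ ≤ 1 / ((j : ℝ) + 1) ∧
      κ * ‖z - z'‖ < realMinValue X f₀ f N z - realMinValue X f₀ f N z' ∧ z ≠ z' := by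
    intro j
    obtain ⟨z, z', hz, hz', h⟩ := hcon (1 / ((j : ℝ) + 1)) (by positivity)
    have hne : z ≠ z' := by
      rintro rfl
      simp at h
    rcases lt_abs.1 h with h | h
    · exact ⟨z, z', hz, hz', h, hne⟩
    · refine ⟨z', z, hz', hz, ?_, hne.symm⟩
      rw [norm_sub_rev]
      linarith
  choose z z' hz hz' hlt hne using hcon'
  have hlim : ∀ y : ℕ → PerturbSpace m,
      (∀ j, ‖y j - WithLp.toLp 2 (ubar, 0)‖ ≤ 1 / ((j : ℝ) + 1)) →
      Tendsto y atTop (𝓝 (WithLp.toLp 2 (ubar, 0))) := fun y hy =>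
    tendsto_iff_norm_sub_tendsto_zero.2 <| squeeze_zero (fun _ => norm_nonneg _) hy
      tendsto_one_div_add_atTop_nhds_zero_nat
  -- Optimality is taken at `z'`, the point with the smaller value, so that passing to worst cases
  -- at `x j` only enlarges the difference.
  choose x hxX hxmin using fun j => exists_realMinValue_eq hXne hXc hf₀ hfc hN (z' j)
  obtain ⟨x₀, -, φ, hφ, hxφ⟩ := hXc.tendsto_subseq hxX
  have hpos : ∀ j, 0 < ‖z j - z' j‖ := fun j => norm_pos_iff.2 (sub_ne_zero.2 (hne j))
  obtain ⟨d, hd, ψ, hψ, hdψ⟩ := (isCompact_sphere (0 : PerturbSpace m) 1).tendsto_subseq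
    (x := fun j => ‖z (φ j) - z' (φ j)‖⁻¹ • (z (φ j) - z' (φ j))) (fun j => by
      simp [norm_smul, (hpos (φ j)).ne'])
  have hz'φ := (hlim z' hz').comp hφ.tendsto_atTop
  have hx₀ : x₀ ∈ nominalMinimizers X f₀ f ubar :=
    mem_nominalMinimizers_of_tendsto hr hXc hf₀ hfc hN (fun j => hxX (φ j))
      (fun j => hxmin (φ j)) hxφ hz'φ
  obtain ⟨i, w, hi, hw, hle⟩ := exists_le_sum_inner_of_quotient hr hf₀ hf hN
    (hxφ.comp hψ.tendsto_atTop)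
    (((hlim z hz).comp hφ.tendsto_atTop).comp hψ.tendsto_atTop)
    (hz'φ.comp hψ.tendsto_atTop) (fun j => hpos (φ (ψ j))) hdψ (tendsto_const_nhds (x := κ))
    (fun j => by
      simp only [Function.comp_apply]
      have h1 := hlt (φ (ψ j))
      have h2 := realMinValue_le hXc hf₀ hfc hN (hxX (φ (ψ j))) (z (φ (ψ j)))
      rw [hxmin (φ (ψ j))] at h1
      linarith)
  have hd1 : ‖d‖ ≤ 1 := by simpa using (mem_sphere_zero_iff_norm.1 hd).le
  linarith [sum_inner_le_sum_sSup_termValues hN hi hw hd1, hB x₀ hx₀]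

theorem lipModulus_le_ofReal {E : Type*} [NormedAddCommGroup E] {p : E → EReal} {P : E → ℝ}
    (hp : ∀ z, p z = P z) {zbar : E} {B : ℝ}
    (h : ∀ κ, B < κ → ∃ ε : ℝ, 0 < ε ∧ ∀ z z', ‖z - zbar‖ ≤ ε → ‖z' - zbar‖ ≤ ε →
      |P z - P z'| ≤ κ * ‖z - z'‖) : lipModulus p zbar ≤ ENNReal.ofReal B := by
  refine ENNReal.le_of_forall_pos_le_add fun η hη _ => ?_
  obtain ⟨ε, hε, hlip⟩ := h (B + η) (by simpa using hη)
  refine le_trans ?_ (ENNReal.ofReal_add_le.trans_eq (by rw [ENNReal.ofReal_coe_nnreal]) :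
    ENNReal.ofReal (B + η) ≤ ENNReal.ofReal B + η)
  refine limsup_le_of_le (by isBoundedDefault) ?_
  have hball : Metric.closedBall zbar ε ×ˢ Metric.closedBall zbar ε ∈ 𝓝 (zbar, zbar) :=
    prod_mem_nhds (Metric.closedBall_mem_nhds _ hε) (Metric.closedBall_mem_nhds _ hε)
  filter_upwards [nhdsWithin_le_nhds hball] with q hq
  have h1 := hlip q.1 q.2 (mem_closedBall_iff_norm.1 hq.1) (mem_closedBall_iff_norm.1 hq.2)
  rw [hp, hp, ← EReal.coe_sub, EReal.abs_def, ← ofReal_norm]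
  refine ENNReal.div_le_of_le_mul ?_
  rw [← ENNReal.ofReal_mul' (norm_nonneg _)]
  exact ENNReal.ofReal_le_ofReal h1

theorem sSup_termValues_of_norm {ubar : ParamSpace m} {k : Fin s} (hk : ∀ w, N k w = ‖w‖)
    (i : Fin (r k)) (x : EuclideanSpace ℝ (Fin n)) :
    sSup (termValues f N ubar k i x) = √2 * ‖grad₁ f ubar k i x‖ := by
  refine IsGreatest.csSup_eq ⟨?_, ?_⟩
  -- The maximizer is the normalized gradient; for a zero gradient the convention `0⁻¹ = 0` gives `w
  -- = 0`.
  · refine ⟨‖grad₁ f ubar k i x‖⁻¹ • grad₁ f ubar k i x, ?_, ?_⟩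
    · rw [Set.mem_ofPred_eq, hk, norm_smul, norm_inv, norm_norm]
      exact inv_mul_le_one
    · simp only [inner_smul_right, real_inner_self_eq_norm_sq]
      have h : ‖grad₁ f ubar k i x‖⁻¹ * ‖grad₁ f ubar k i x‖ ^ 2 = ‖grad₁ f ubar k i x‖ := by
        rcases eq_or_ne ‖grad₁ f ubar k i x‖ 0 with h | h
        · simp [h]
        · field_simp
      rw [h, ← two_mul, Real.sqrt_mul zero_le_two, Real.sqrt_sq (norm_nonneg _)]
  · rintro _ ⟨w, hw, rfl⟩
    have h1 := abs_real_inner_le_norm (grad₁ f ubar k i x) w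
    have h2 : ‖w‖ ≤ 1 := by rw [← hk]; exact hw
    have h3 : |inner ℝ (grad₁ f ubar k i x) w| ≤ ‖grad₁ f ubar k i x‖ :=
      h1.trans (mul_le_of_le_one_right (norm_nonneg _) h2)
    refine Real.sqrt_le_iff.2 ⟨by positivity, ?_⟩
    rw [mul_pow, Real.sq_sqrt zero_le_two]
    have h4 := sq_le_sq' (by linarith [abs_nonneg (inner ℝ (grad₁ f ubar k i x) w)]) h3
    rw [sq_abs] at h4
    linarith

end Modulus

section Subgradients

variable {s n : ℕ} {m r : Fin s → ℕ}

/-! ### Limiting subgradients -/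

/-- Multipliers `y` in the simplices over `I k`, together with vectors `v k i` in the ball of
radius `y k i` for the norm `N k`. -/
def multiplierSet (N : ∀ k, Seminorm ℝ (EuclideanSpace ℝ (Fin (m k))))
    (I : ∀ k, Finset (Fin (r k))) :
    Set ((∀ k, Fin (r k) → ℝ) × (∀ k, Fin (r k) → EuclideanSpace ℝ (Fin (m k)))) :=
  {p | (∀ k, ∀ i ∉ I k, p.1 k i = 0) ∧ (∀ k, ∑ i ∈ I k, p.1 k i = 1) ∧
    ∀ k i, N k (p.2 k i) ≤ p.1 k i}

/-- The linear map `(y, v) ↦ ((∑ᵢ y k i • a k i)ₖ, ∑ₖ ∑ᵢ ⟪a k i, v k i⟫)`. -/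
noncomputable def multiplierMap (I : ∀ k, Finset (Fin (r k)))
    (a : ∀ k, Fin (r k) → EuclideanSpace ℝ (Fin (m k))) :
    ((∀ k, Fin (r k) → ℝ) × (∀ k, Fin (r k) → EuclideanSpace ℝ (Fin (m k)))) →ₗ[ℝ]
      PerturbSpace m where
  toFun p := WithLp.toLp 2 (WithLp.toLp 2 fun k => ∑ i ∈ I k, p.1 k i • a k i,
    ∑ k, ∑ i ∈ I k, inner ℝ (a k i) (p.2 k i))
  map_add' p q := by
    simp only [Prod.fst_add, Prod.snd_add, Pi.add_apply, add_smul, inner_add_right,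
      Finset.sum_add_distrib]
    rfl
  map_smul' c p := by
    simp only [Prod.smul_fst, Prod.smul_snd, Pi.smul_apply, smul_assoc, inner_smul_right,
      ← Finset.smul_sum, ← Finset.mul_sum]
    rfl

/-- The variable `v k i` stands for `y k i • w k i`. In these variables the constraints are convex
and the subgradient formula is linear, which fails for the pair `(y, w)`. -/
theorem convex_multiplierSet (N : ∀ k, Seminorm ℝ (EuclideanSpace ℝ (Fin (m k))))
    (I : ∀ k, Finset (Fin (r k))) : Convex ℝ (multiplierSet N I) := by
  rintro p ⟨hp0, hp1, hp2⟩ q ⟨hq0, hq1, hq2⟩ a b ha hb hab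
  refine ⟨fun k i hi => ?_, fun k => ?_, fun k i => ?_⟩
  · simp [hp0 k i hi, hq0 k i hi]
  · simp [Finset.sum_add_distrib, ← Finset.mul_sum, hp1, hq1, hab]
  · calc N k (a • p.2 k i + b • q.2 k i) ≤ N k (a • p.2 k i) + N k (b • q.2 k i) :=
          map_add_le_add _ _ _
      _ = a * N k (p.2 k i) + b * N k (q.2 k i) := by
          rw [map_smul_eq_mul, map_smul_eq_mul, Real.norm_of_nonneg ha, Real.norm_of_nonneg hb]
      _ ≤ a * p.1 k i + b * q.1 k i := by
          gcongr
          · exact hp2 k i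
          · exact hq2 k i

theorem isCompact_multiplierSet (N : ∀ k, Seminorm ℝ (EuclideanSpace ℝ (Fin (m k))))
    (hN : ∀ k w, N k w = 0 → w = 0) (I : ∀ k, Finset (Fin (r k))) :
    IsCompact (multiplierSet N I) := by
  have hK : IsCompact ((Set.univ.pi fun k => Set.univ.pi fun _ : Fin (r k) => Set.Icc (0 : ℝ) 1) ×ˢ
      (Set.univ.pi fun k => Set.univ.pi fun _ : Fin (r k) => {w | N k w ≤ 1})) :=
    (isCompact_univ_pi fun k => isCompact_univ_pi fun _ => isCompact_Icc).prod
      (isCompact_univ_pi fun k => isCompact_univ_pi fun _ =>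
        (N k).isCompact_setOf_le_of_definite (hN k) 1)
  refine hK.of_isClosed_subset ?_ ?_
  · have h1 : ∀ k i, Continuous fun p : (∀ k, Fin (r k) → ℝ) ×
        (∀ k, Fin (r k) → EuclideanSpace ℝ (Fin (m k))) => p.1 k i := fun k i => by fun_prop
    have h2 : ∀ k i, Continuous fun p : (∀ k, Fin (r k) → ℝ) ×
        (∀ k, Fin (r k) → EuclideanSpace ℝ (Fin (m k))) => N k (p.2 k i) := fun k i =>
      (N k).continuous_finiteDimensional.comp (by fun_prop)
    simp only [multiplierSet, Set.ofPred_and, Set.ofPred_forall]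
    refine IsClosed.inter ?_ (IsClosed.inter ?_ ?_)
    · exact isClosed_iInter fun k => isClosed_iInter fun i => isClosed_iInter fun _ =>
        isClosed_eq (h1 k i) continuous_const
    · exact isClosed_iInter fun k => isClosed_eq (continuous_finsetSum _ fun i _ => h1 k i)
        continuous_const
    · exact isClosed_iInter fun k => isClosed_iInter fun i => isClosed_le (h2 k i) (h1 k i)
  · rintro p ⟨hp0, hp1, hp2⟩
    -- Nonnegativity of the multipliers is implicit in `N k (v k i) ≤ y k i`.
    have hnn : ∀ k i, 0 ≤ p.1 k i := fun k i => (apply_nonneg _ _).trans (hp2 k i)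
    have hle : ∀ k i, p.1 k i ≤ 1 := fun k i => by
      by_cases hi : i ∈ I k
      · exact (Finset.single_le_sum (fun i _ => hnn k i) hi).trans_eq (hp1 k)
      · rw [hp0 k i hi]
        exact zero_le_one
    exact ⟨fun k _ i _ => ⟨hnn k i, hle k i⟩, fun k _ i _ => (hp2 k i).trans (hle k i)⟩

theorem inner_multiplierMap (I : ∀ k, Finset (Fin (r k)))
    (a : ∀ k, Fin (r k) → EuclideanSpace ℝ (Fin (m k))) (d : PerturbSpace m)
    (p : (∀ k, Fin (r k) → ℝ) × (∀ k, Fin (r k) → EuclideanSpace ℝ (Fin (m k)))) :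
    inner ℝ d (multiplierMap I a p) = ∑ k, ∑ i ∈ I k,
      (p.1 k i * inner ℝ (a k i) (d.fst k) + d.snd * inner ℝ (a k i) (p.2 k i)) := by
  rw [WithLp.prod_inner_apply, PiLp.inner_apply, Real.inner_apply]
  change ∑ k, inner ℝ (d.fst k) (∑ i ∈ I k, p.1 k i • a k i) +
    d.snd * ∑ k, ∑ i ∈ I k, inner ℝ (a k i) (p.2 k i) = _
  simp only [inner_sum, inner_smul_right, Finset.mul_sum, Finset.sum_add_distrib,
    real_inner_comm]

/-- The selection in `h` may vary with `d`. If `v` were outside the compact convex image, `h`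
applied to a strictly separating direction would contradict the separation. -/
theorem mem_image_multiplierMap_of_forall_le
    (N : ∀ k, Seminorm ℝ (EuclideanSpace ℝ (Fin (m k))))
    (hN : ∀ k w, N k w = 0 → w = 0) (I : ∀ k, Finset (Fin (r k)))
    (a : ∀ k, Fin (r k) → EuclideanSpace ℝ (Fin (m k))) (v : PerturbSpace m)
    (h : ∀ d : PerturbSpace m, ∃ (i : ∀ k, Fin (r k)) (w : ParamSpace m), (∀ k, i k ∈ I k) ∧
      w ∈ unitBalls N ∧ inner ℝ d v ≤ ∑ k, inner ℝ (a k (i k)) (d.fst k + d.snd • w k)) :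
    v ∈ multiplierMap I a '' multiplierSet N I := by
  by_contra hv
  have hclosed : IsClosed (multiplierMap I a '' multiplierSet N I) :=
    ((isCompact_multiplierSet N hN I).image
      (LinearMap.continuous_of_finiteDimensional _)).isClosed
  obtain ⟨φ, c, hφ, hc⟩ := geometric_hahn_banach_closed_point
    ((convex_multiplierSet N I).linear_image _) hclosed hv
  set d := (InnerProductSpace.toDual ℝ (PerturbSpace m)).symm φ
  have hd : ∀ q, φ q = inner ℝ d q := fun q =>
    (InnerProductSpace.toDual_symm_apply (x := q) (y := φ)).symm
  obtain ⟨i, w, hi, hw, hle⟩ := h d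
  -- The selection viewed as a multiplier: all weight of block `k` sits on `i k`.
  let p : (∀ k, Fin (r k) → ℝ) × (∀ k, Fin (r k) → EuclideanSpace ℝ (Fin (m k))) :=
    (fun k => Pi.single (i k) 1, fun k => Pi.single (i k) (w k))
  have hp : p ∈ multiplierSet N I := by
    refine ⟨fun k j hj => ?_, fun k => ?_, fun k j => ?_⟩
    · exact Pi.single_eq_of_ne (fun hji : j = i k => hj (hji ▸ hi k)) _
    · simp [p, Finset.sum_pi_single', hi]
    · rcases eq_or_ne j (i k) with rfl | hj
      · simpa [p] using hw k
      · simp [p, Pi.single_eq_of_ne hj]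
  have h1 := hφ _ ⟨p, hp, rfl⟩
  rw [hd, inner_multiplierMap] at h1
  rw [hd] at hc
  have h2 : ∀ k, ∑ j ∈ I k,
      (p.1 k j * inner ℝ (a k j) (d.fst k) + d.snd * inner ℝ (a k j) (p.2 k j)) =
      inner ℝ (a k (i k)) (d.fst k + d.snd • w k) := by
    intro k
    rw [Finset.sum_eq_single_of_mem (i k) (hi k) fun j _ hj => by
      simp [p, Pi.single_eq_of_ne hj]]
    simp [p, inner_add_right, inner_smul_right]
  simp only [h2] at h1
  linarith

variable {X : Set (EuclideanSpace ℝ (Fin n))} {f₀ : EuclideanSpace ℝ (Fin n) → ℝ}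
  {f : ∀ k : Fin s, Fin (r k) → EuclideanSpace ℝ (Fin (m k)) → EuclideanSpace ℝ (Fin n) → ℝ}
  {N : ∀ k, Seminorm ℝ (EuclideanSpace ℝ (Fin (m k)))}

/-- One `ε` serves as both the error tolerance and the bound on `t`, so `ε = 1 / (j + 1)` later
makes both vanish. -/
theorem IsRegularSubgradient.exists_mul_le {E : Type*} [NormedAddCommGroup E]
    [InnerProductSpace ℝ E] {p : E → EReal} {P : E → ℝ} (hp : ∀ z, p z = P z) {z v : E}
    (h : IsRegularSubgradient p z v) (d : E) {ε : ℝ} (hε : 0 < ε) :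
    ∃ t : ℝ, 0 < t ∧ t < ε ∧ t * (inner ℝ v d - ε * ‖d‖) ≤ P (z + t • d) - P z := by
  have h1 : Tendsto (fun t : ℝ => z + t • d) (𝓝[>] 0) (𝓝 z) := by
    have : Continuous fun t : ℝ => z + t • d := by fun_prop
    exact (this.tendsto' 0 z (by simp)).mono_left nhdsWithin_le_nhds
  have h2 := h1.eventually (h.2.2 ε hε)
  obtain ⟨t, ht, ht0, htε⟩ := (h2.and (Ioo_mem_nhdsGT hε)).exists
  refine ⟨t, ht0, htε, ?_⟩
  rw [hp, hp, ← EReal.coe_add, EReal.coe_le_coe_iff, add_sub_cancel_left, inner_smul_right,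
    norm_smul, Real.norm_of_nonneg ht0.le] at ht
  linarith

/-- The point `x` is a cluster point of minimizers at `zs j` and is fixed before `d`. At such a
minimizer, the increment of `p` along `d` is at most that of the worst case, while the regular
subgradient bounds it from below. -/
theorem exists_forall_inner_le_of_isLimitingSubgradient (hr : ∀ k, 0 < r k) (hXne : X.Nonempty)
    (hXc : IsCompact X) (hf₀ : Continuous f₀)
    (hf : ∀ k i, ContDiff ℝ 1
      (fun z : EuclideanSpace ℝ (Fin (m k)) × EuclideanSpace ℝ (Fin n) => f k i z.1 z.2))
    (hN : ∀ k w, N k w = 0 → w = 0) {ubar : ParamSpace m} {v : PerturbSpace m}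
    (hv : IsLimitingSubgradient (minValue X f₀ f N) (WithLp.toLp 2 (ubar, 0)) v) :
    ∃ x ∈ nominalMinimizers X f₀ f ubar, ∀ d : PerturbSpace m,
      ∃ (i : ∀ k, Fin (r k)) (w : ParamSpace m), (∀ k, i k ∈ activeIndices f ubar k x) ∧
        w ∈ unitBalls N ∧
        inner ℝ d v ≤ ∑ k, inner ℝ (grad₁ f ubar k (i k) x) (d.fst k + d.snd • w k) := by
  have hfc := fun k i => (hf k i).continuous
  have hp := minValue_eq_coe hr hXne hXc hf₀ hfc hN
  obtain ⟨-, -, zs, vs, hzs, -, hreg, hvs⟩ := hv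
  choose x hxX hxmin using fun j => exists_realMinValue_eq hXne hXc hf₀ hfc hN (zs j)
  obtain ⟨x₀, -, φ, hφ, hxφ⟩ := hXc.tendsto_subseq hxX
  have hφ' := hφ.tendsto_atTop
  refine ⟨x₀, mem_nominalMinimizers_of_tendsto hr hXc hf₀ hfc hN (fun j => hxX (φ j))
    (fun j => hxmin (φ j)) hxφ (hzs.comp hφ'), fun d => ?_⟩
  choose t ht0 htlt ht using fun j : ℕ =>
    (hreg j).exists_mul_le hp d (Nat.one_div_pos_of_nat (α := ℝ) (n := j))
  have hlim0 := tendsto_one_div_add_atTop_nhds_zero_nat (𝕜 := ℝ)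
  have htlim : Tendsto t atTop (𝓝 0) :=
    squeeze_zero (fun j => (ht0 j).le) (fun j => (htlt j).le) hlim0
  have hz' : Tendsto (fun j => zs j + t j • d) atTop (𝓝 (WithLp.toLp 2 (ubar, 0))) := by
    simpa using hzs.add (htlim.smul_const d)
  have hb : Tendsto (fun j : ℕ => inner ℝ (vs j) d - 1 / ((j : ℝ) + 1) * ‖d‖) atTop
      (𝓝 (inner ℝ d v)) := by
    have h := (hvs.inner (tendsto_const_nhds (x := d))).sub (hlim0.mul_const ‖d‖)
    rwa [zero_mul, sub_zero, real_inner_comm] at h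
  refine exists_le_sum_inner_of_quotient hr hf₀ hf hN hxφ (hz'.comp hφ') (hzs.comp hφ')
    (fun j => ht0 (φ j)) ?_ (hb.comp hφ') fun j => ?_
  · refine tendsto_const_nhds.congr fun j => ?_
    simp [(ht0 (φ j)).ne']
  · have h1 := ht (φ j)
    have h2 := realMinValue_le hXc hf₀ hfc hN (hxX (φ j)) (zs (φ j) + t (φ j) • d)
    rw [hxmin (φ j)] at h1
    simp only [Function.comp_apply]
    linarith

end Subgradients

/-! ### The sensitivity theorem -/

theorem theorem1 {s n : ℕ} {m r : Fin s → ℕ} (hr : ∀ k, 0 < r k)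
    (X : Set (EuclideanSpace ℝ (Fin n))) (hXne : X.Nonempty) (hXc : IsCompact X)
    (f₀ : EuclideanSpace ℝ (Fin n) → ℝ) (hf₀ : LocallyLipschitz f₀)
    (f : ∀ k : Fin s, Fin (r k) → EuclideanSpace ℝ (Fin (m k)) → EuclideanSpace ℝ (Fin n) → ℝ)
    (hf : ∀ k i, ContDiff ℝ 1
      (fun z : EuclideanSpace ℝ (Fin (m k)) × EuclideanSpace ℝ (Fin n) => f k i z.1 z.2))
    (N : ∀ k, Seminorm ℝ (EuclideanSpace ℝ (Fin (m k))))
    (hN : ∀ k w, N k w = 0 → w = 0)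
    (ubar : ParamSpace m) :
    LocLipschitzAt (minValue X f₀ f N) (WithLp.toLp 2 (ubar, 0)) ∧
    (∀ k i x, IsGreatest (termValues f N ubar k i x) (sSup (termValues f N ubar k i x))) ∧
    (∃ B : ℝ,
      IsGreatest
        ((fun x => ∑ k, ∑ i ∈ activeIndices f ubar k x, sSup (termValues f N ubar k i x)) ''
          nominalMinimizers X f₀ f ubar) B ∧
      lipModulus (minValue X f₀ f N) (WithLp.toLp 2 (ubar, 0)) ≤ ENNReal.ofReal B ∧
      ((∀ k w, N k w = ‖w‖) →
        ∃ B' : ℝ,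
          IsGreatest
            ((fun x => ∑ k, ∑ i ∈ activeIndices f ubar k x, ‖grad₁ f ubar k i x‖) ''
              nominalMinimizers X f₀ f ubar) B' ∧
          B = √2 * B')) ∧
    (∀ (g : ParamSpace m) (γ : ℝ),
      IsLimitingSubgradient (minValue X f₀ f N) (WithLp.toLp 2 (ubar, 0))
        (WithLp.toLp 2 (g, γ)) →
      ∃ x ∈ nominalMinimizers X f₀ f ubar,
        ∃ (w : ∀ k, Fin (r k) → EuclideanSpace ℝ (Fin (m k))) (y : ∀ k, Fin (r k) → ℝ),
          (∀ k i, N k (w k i) ≤ 1) ∧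
          (∀ k, ∀ i ∈ activeIndices f ubar k x, 0 ≤ y k i) ∧
          (∀ k, ∑ i ∈ activeIndices f ubar k x, y k i = 1) ∧
          (∀ k, g k = ∑ i ∈ activeIndices f ubar k x, y k i • grad₁ f ubar k i x) ∧
          γ = ∑ k, ∑ i ∈ activeIndices f ubar k x,
            y k i * inner ℝ (grad₁ f ubar k i x) (w k i)) := by
  have hfc := fun k i => (hf k i).continuous
  have hp := minValue_eq_coe hr hXne hXc hf₀.continuous hfc hN
  obtain ⟨x₀, hx₀, hmax⟩ :=
    exists_isGreatest_sum_sSup_termValues hr hXne hXc hf₀.continuous hf hN ubar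
  have hlip := fun κ =>
    exists_lipschitz_realMinValue (κ := κ) hr hXne hXc hf₀.continuous hf hN hmax
  refine ⟨?_, isGreatest_termValues hN ubar, ⟨_, ⟨⟨x₀, hx₀, rfl⟩, ?_⟩,
    lipModulus_le_ofReal hp hlip, fun hnorm => ?_⟩, fun g γ hgγ => ?_⟩
  · obtain ⟨ε, hε, h⟩ := hlip _ (lt_add_one _)
    refine ⟨(∑ k, ∑ i ∈ activeIndices f ubar k x₀, sSup (termValues f N ubar k i x₀)) + 1, ε,
      add_nonneg (Finset.sum_nonneg fun k _ => Finset.sum_nonneg fun i _ =>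
        sSup_termValues_nonneg ubar k i x₀) zero_le_one, hε, fun z _ => ?_, fun z z' hz hz' => ?_⟩
    · rw [hp]
      exact ⟨EReal.coe_ne_top _, EReal.coe_ne_bot _⟩
    · rw [hp, hp, EReal.toReal_coe, EReal.toReal_coe]
      exact h z z' hz hz'
  · rintro _ ⟨x, hx, rfl⟩
    exact hmax x hx
  · have hterm : ∀ x, ∑ k, ∑ i ∈ activeIndices f ubar k x, sSup (termValues f N ubar k i x) =
        √2 * ∑ k, ∑ i ∈ activeIndices f ubar k x, ‖grad₁ f ubar k i x‖ := fun x => by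
      simp only [sSup_termValues_of_norm (hnorm _), Finset.mul_sum]
    refine ⟨_, ⟨⟨x₀, hx₀, rfl⟩, ?_⟩, hterm x₀⟩
    rintro _ ⟨x, hx, rfl⟩
    have h := hmax x hx
    rw [hterm, hterm] at h
    exact le_of_mul_le_mul_left h (by positivity)
  · obtain ⟨x, hx, h⟩ :=
      exists_forall_inner_le_of_isLimitingSubgradient hr hXne hXc hf₀.continuous hf hN hgγ
    obtain ⟨⟨y, v⟩, ⟨hy0, hy1, hv⟩, heq⟩ := mem_image_multiplierMap_of_forall_le N hN
      (fun k => activeIndices f ubar k x) (fun k i => grad₁ f ubar k i x) _ h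
    have hy : ∀ k i, 0 ≤ y k i := fun k i => (apply_nonneg _ _).trans (hv k i)
    -- Undo `v = y • w`. Where `y k i = 0` the formula gives `w k i = 0`, which is consistent since
    -- definiteness then forces `v k i = 0`.
    refine ⟨x, hx, fun k i => (y k i)⁻¹ • v k i, y, fun k i => ?_, fun k i _ => hy k i, hy1,
      fun k => ?_, ?_⟩
    · rw [map_smul_eq_mul, Real.norm_of_nonneg (inv_nonneg.2 (hy k i))]
      exact (mul_le_mul_of_nonneg_left (hv k i) (inv_nonneg.2 (hy k i))).trans inv_mul_le_one
    · exact (congrArg (fun q : PerturbSpace m => q.fst k) heq).symm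
    · refine (congrArg (fun q : PerturbSpace m => q.snd) heq).symm.trans ?_
      change ∑ k, ∑ i ∈ activeIndices f ubar k x, inner ℝ (grad₁ f ubar k i x) (v k i) = _
      refine Finset.sum_congr rfl fun k _ => Finset.sum_congr rfl fun i _ => ?_
      rw [inner_smul_right]
      rcases eq_or_ne (y k i) 0 with h0 | h0
      · have h1 : v k i = 0 := hN k _ (le_antisymm ((hv k i).trans_eq h0) (apply_nonneg _ _))
        simp [h1]
      · rw [mul_inv_cancel_left₀ h0]
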